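/- Fix a set $\Lambda$. Modal formulas are built from propositional variables $p_0,p_1,p_2,\dots$ with $\bot$, $\to$ and $\Diamond_\lambda$ ($\lambda\in\Lambda$); $\neg\phi:=\phi\to\bot$ and $\Box_\lambda\phi:=\neg\Diamond_\lambda\neg\phi$. A Kripke frame $\mathfrak F=(W,(R_\lambda)_{\lambda\in\Lambda})$ is a set with binary relations, and $\mathfrak F\models\phi$ means that $\phi$ is true at every point of $\mathfrak F$ under every valuation of the variables. A normal modal logic is a set of modal formulas that contains the propositional tautologies, the formulas $\Box_\lambda(p\to q)\to(\Box_\lambda p\to\Box_\lambda q)$ and $\Diamond_\lambda p\leftrightarrow\neg\Box_\lambda\neg p$, and is closed under modus ponens, uniform substitution and necessitation. For a set $\Sigma$ of modal formulas, $\mathsf K+\Sigma$ is the least normal modal logic containing $\Sigma$, and $\Sigma$ is said to axiomatise $\mathsf K+\Sigma$. The canonical frame of a normal modal logic $L$ has the maximal $L$-consistent sets as points, with $w R_\lambda w'$ iff $\Diamond_\lambda\phi\in w$ for all $\phi\in w'$. A formula $\phi$ is canonical if it is valid in the canonical frame of $\mathsf K+\{\phi\}$. An inverse system of Kripke frames consists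 of an upwards-directed non-empty partially ordered set $I$, Kripke frames $\mathfrak F_i=(W_i,((R_i)_\lambda)_{\lambda\in\Lambda})$ for $i\in I$, and p-morphisms $f_{ij}:\mathfrak F_i\to\mathfrak F_j$ for $i\ge j$, with $f_{ii}=\mathrm{id}$ and $f_{jk}\circ f_{ij}=f_{ik}$ for $i\ge j\ge k$. Its inverse limit $\varprojlim\mathfrak F_i$ is the frame with points $x\in\prod_i W_i$ such that $f_{ij}(x_i)=x_j$ for all $i\ge j$, and with $xR_\lambda y$ iff $x_i(R_i)_\lambda y_i$ for all $i$. **Lemma.** Let $(\gamma_i)_{i\in\omega}$ be a sequence of modal formulas such that, whenever $i_2<i_1$, $\gamma_{i_1}$ implies $\gamma_{i_2}$ in the sense that every Kripke frame validating $\gamma_{i_1}$ validates $\gamma_{i_2}$. Suppose that for every $l$ there is $n$ such that for every $k$ there is an inverse system $\{\mathfrak F_i\}$ of finite Kripke frames over a countable index set (for example, over $\omega$) such that 1. $\mathfrak F_i\models\gamma_k$ for all $i$; 2. $\varprojlim\mathfrak F_i\models\gamma_l$; 3. $\varprojlim\mathfrak F_i\not\models\gamma_n$. Then every set of modal formulas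 that axiomatises $L=\mathsf K+\{\gamma_n:n\in\omega\}$ contains infinitely many non-canonical formulas. -/

import Mathlib

universe u v

/-- Modal formulas over the propositional variables `p 0, p 1, …` and the set of indices `Λ`,
built with `⊥`, `→` and the diamonds `◇_l`, `l ∈ Λ`. -/
inductive ModalFormula (Λ : Type u) : Type u where
  | var (p : ℕ) : ModalFormula Λ
  | bot : ModalFormula Λ
  | imp (φ ψ : ModalFormula Λ) : ModalFormula Λ
  | dia (l : Λ) (φ : ModalFormula Λ) : ModalFormula Λ

namespace ModalFormula

variable {Λ : Type u}

/-- `¬ φ` is `φ → ⊥`. -/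
def neg (φ : ModalFormula Λ) : ModalFormula Λ := imp φ bot

/-- `□_l φ` is `¬ ◇_l ¬ φ`. -/
def box (l : Λ) (φ : ModalFormula Λ) : ModalFormula Λ := neg (dia l (neg φ))

/-- Simultaneous substitution of `σ p` for every variable `p`. -/
def subst (σ : ℕ → ModalFormula Λ) : ModalFormula Λ → ModalFormula Λ
  | var p => σ p
  | bot => bot
  | imp φ ψ => imp (subst σ φ) (subst σ ψ)
  | dia l φ => dia l (subst σ φ)

/-- `φ[ψ/p]`. -/
def substVar (p : ℕ) (ψ φ : ModalFormula Λ) : ModalFormula Λ :=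
  subst (Function.update var p ψ) φ

/-- Propositional tautologies (and their substitution instances): formulas true under every Boolean
valuation of all formulas, where variables and formulas `◇_l φ` are treated as atoms. -/
def IsTautology (φ : ModalFormula Λ) : Prop :=
  ∀ t : ModalFormula Λ → Prop, ¬ t bot → (∀ α β, t (imp α β) ↔ (t α → t β)) → t φ

/-- `φ₁ → (φ₂ → … (φₙ → χ))`. -/
def impList (Γ : List (ModalFormula Λ)) (χ : ModalFormula Λ) : ModalFormula Λ :=
  Γ.foldr imp χ

end ModalFormula

/-- A Kripke frame: a set with a family of binary relations indexed by `Λ`. -/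
structure KripkeFrame (Λ : Type u) where
  W : Type v
  R : Λ → W → W → Prop

namespace KripkeFrame

variable {Λ : Type u}

/-- Truth of a modal formula at a point under a propositional valuation. -/
def Sat (F : KripkeFrame.{u, v} Λ) (θ : ℕ → Set F.W) : F.W → ModalFormula Λ → Prop
  | w, .var p => w ∈ θ p
  | _, .bot => False
  | w, .imp φ ψ => F.Sat θ w φ → F.Sat θ w ψ
  | w, .dia l φ => ∃ y, F.R l w y ∧ F.Sat θ y φ

/-- Validity of a modal formula in a Kripke frame. -/
def Validates (F : KripkeFrame.{u, v} Λ) (φ : ModalFormula Λ) : Prop :=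
  ∀ (θ : ℕ → Set F.W) (w : F.W), F.Sat θ w φ

/-- Frame homomorphisms, i.e. p-morphisms (bounded morphisms). -/
structure IsPMorphism (F G : KripkeFrame.{u, v} Λ) (f : F.W → G.W) : Prop where
  forth : ∀ l x y, F.R l x y → G.R l (f x) (f y)
  back : ∀ l x z, G.R l (f x) z → ∃ y, F.R l x y ∧ f y = z

end KripkeFrame

section Logic

variable {Λ : Type u}

open ModalFormula

/-- Normal modal logics. The clause `dual`, i.e. `◇_l p ↔ ¬ □_l ¬ p`, is part of the definition
because `◇_l` is the primitive modality and `□_l` is an abbreviation. -/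
structure IsNormalLogic (L : Set (ModalFormula Λ)) : Prop where
  taut : ∀ φ, IsTautology φ → φ ∈ L
  axK : ∀ l, imp (box l (imp (var 0) (var 1))) (imp (box l (var 0)) (box l (var 1))) ∈ L
  dual : ∀ l, imp (dia l (var 0)) (neg (box l (neg (var 0)))) ∈ L ∧
    imp (neg (box l (neg (var 0)))) (dia l (var 0)) ∈ L
  mp : ∀ φ ψ, φ ∈ L → imp φ ψ ∈ L → ψ ∈ L
  us : ∀ φ ψ p, φ ∈ L → substVar p ψ φ ∈ L
  nec : ∀ l φ, φ ∈ L → box l φ ∈ L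

/-- `Σ` axiomatises `L`: `L` is the least normal modal logic containing `Σ`. -/
def Axiomatises (S L : Set (ModalFormula Λ)) : Prop :=
  IsLeast {M | IsNormalLogic M ∧ S ⊆ M} L

/-- The logic `K + Σ`. -/
def KPlus (S : Set (ModalFormula Λ)) : Set (ModalFormula Λ) :=
  ⋂₀ {M | IsNormalLogic M ∧ S ⊆ M}

theorem axiomatises_KPlus (S : Set (ModalFormula Λ)) : Axiomatises S (KPlus S) := by
  refine ⟨⟨⟨?_, ?_, ?_, ?_, ?_, ?_⟩, ?_⟩, ?_⟩
  · exact fun φ h M hM => hM.1.taut φ h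
  · exact fun l M hM => hM.1.axK l
  · exact fun l => ⟨fun M hM => (hM.1.dual l).1, fun M hM => (hM.1.dual l).2⟩
  · exact fun φ ψ h h' M hM => hM.1.mp φ ψ (h M hM) (h' M hM)
  · exact fun φ ψ p h M hM => hM.1.us φ ψ p (h M hM)
  · exact fun l φ h M hM => hM.1.nec l φ (h M hM)
  · exact fun φ h M hM => hM.2 h
  · exact fun M hM => Set.sInter_subset_of_mem hM

/-- `Γ` is `L`-consistent: `L` contains no formula `φ₁ → (… → (φₙ → ⊥))` with all `φᵢ ∈ Γ`. -/
def IsConsistent (L Γ : Set (ModalFormula Λ)) : Prop :=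
  ∀ Δ : List (ModalFormula Λ), (∀ φ ∈ Δ, φ ∈ Γ) → impList Δ bot ∉ L

/-- Maximal `L`-consistent sets. -/
def IsMCS (L Γ : Set (ModalFormula Λ)) : Prop :=
  Maximal (IsConsistent L) Γ

/-- The canonical frame of `L`. -/
def canonicalFrame (L : Set (ModalFormula Λ)) : KripkeFrame.{u, u} Λ where
  W := {Γ : Set (ModalFormula Λ) // IsMCS L Γ}
  R l Γ Δ := ∀ φ ∈ Δ.1, dia l φ ∈ Γ.1

/-- A formula is canonical if it is valid in the canonical frame of the logic it axiomatises. -/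
def IsCanonical (φ : ModalFormula Λ) : Prop :=
  (canonicalFrame (KPlus {φ})).Validates φ

end Logic

/-- An inverse system of Kripke frames over the poset `I`, with the maps `f_{ij} : F_i → F_j` for
`j ≤ i`. -/
structure KripkeInverseSystem (Λ : Type u) (I : Type) [PartialOrder I] where
  frame : I → KripkeFrame.{u, v} Λ
  map : ∀ i j, j ≤ i → (frame i).W → (frame j).W
  isPMorphism : ∀ i j (h : j ≤ i), (frame i).IsPMorphism (frame j) (map i j h)
  map_id : ∀ i x, map i i le_rfl x = x
  map_comp : ∀ i j k (hji : j ≤ i) (hkj : k ≤ j) x,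
    map j k hkj (map i j hji x) = map i k (hkj.trans hji) x

/-- The inverse limit of an inverse system of Kripke frames. -/
def KripkeInverseSystem.limit {Λ : Type u} {I : Type} [PartialOrder I]
    (S : KripkeInverseSystem.{u, v} Λ I) : KripkeFrame.{u, v} Λ where
  W := {x : ∀ i, (S.frame i).W // ∀ i j (h : j ≤ i), S.map i j h (x i) = x j}
  R l x y := ∀ i, (S.frame i).R l (x.1 i) (y.1 i)

-- The key fact (`limit_validates_of_isCanonical`) is that a canonical formula valid in all stages
-- of a countable inverse system of finite frames is valid in the limit. Name every set determined
-- by one coordinate by a variable and send each limit point to its theory. This embeds the limit in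
-- the canonical frame as a generated subframe: such sets separate points, their valuations are
-- evaluated at a finite stage (soundness), and compactness gives the back condition.
--
-- If an axiomatisation had finitely many non-canonical members, some `γ l` would imply them all.
-- For the matching `n`, finitely many axioms `B` imply `γ n`, and some `γ k` implies `B`. In the
-- limit for this `k`, canonical members of `B` survive and the others follow from `γ l`, so `γ n`
-- holds: a contradiction.

universe w

namespace ModalFormula

variable {Λ : Type u}

theorem eval_impList {t : ModalFormula Λ → Prop} (hbot : ¬ t bot)
    (himp : ∀ α β, t (imp α β) ↔ (t α → t β)) (Δ : List (ModalFormula Λ)) :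
    t (impList Δ bot) ↔ ¬ ∀ φ ∈ Δ, t φ := by
  induction Δ with
  | nil => simpa [impList] using hbot
  | cons a Δ ih =>
    have h : impList (a :: Δ) bot = imp a (impList Δ bot) := rfl
    rw [h, himp, ih, List.forall_mem_cons]
    tauto

end ModalFormula

open ModalFormula

/-! ### Truth, p-morphisms and soundness for general frames -/

namespace KripkeFrame

variable {Λ : Type u}

section Sat

variable (F : KripkeFrame.{u, v} Λ) (θ : ℕ → Set F.W) (w : F.W)

theorem sat_imp (φ ψ : ModalFormula Λ) :
    F.Sat θ w (imp φ ψ) ↔ (F.Sat θ w φ → F.Sat θ w ψ) := Iff.rfl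

theorem sat_dia (l : Λ) (φ : ModalFormula Λ) :
    F.Sat θ w (dia l φ) ↔ ∃ y, F.R l w y ∧ F.Sat θ y φ := Iff.rfl

theorem sat_neg (φ : ModalFormula Λ) : F.Sat θ w (neg φ) ↔ ¬ F.Sat θ w φ := Iff.rfl

theorem sat_box (l : Λ) (φ : ModalFormula Λ) :
    F.Sat θ w (box l φ) ↔ ∀ y, F.R l w y → F.Sat θ y φ := by
  simp only [box, sat_neg, sat_dia]
  push Not
  rfl

theorem sat_of_isTautology {φ : ModalFormula Λ} (h : IsTautology φ) : F.Sat θ w φ :=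
  h (F.Sat θ w) id fun _ _ => Iff.rfl

theorem sat_impList_bot (Δ : List (ModalFormula Λ)) :
    F.Sat θ w (impList Δ bot) ↔ ¬ ∀ φ ∈ Δ, F.Sat θ w φ :=
  eval_impList (t := F.Sat θ w) id (fun _ _ => Iff.rfl) Δ

theorem sat_subst (σ : ℕ → ModalFormula Λ) (φ : ModalFormula Λ) :
    F.Sat θ w (subst σ φ) ↔ F.Sat (fun p => {x | F.Sat θ x (σ p)}) w φ := by
  induction φ generalizing w with
  | var p => rfl
  | bot => rfl
  | imp φ ψ ih₁ ih₂ => simp only [subst, sat_imp, ih₁, ih₂]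
  | dia l φ ih => simp only [subst, sat_dia, ih]

end Sat

/-- Truth is invariant under bounded morphisms, here between frames in different universes. -/
theorem sat_comap {F : KripkeFrame.{u, v} Λ} {G : KripkeFrame.{u, w} Λ} {f : F.W → G.W}
    (forth : ∀ l x y, F.R l x y → G.R l (f x) (f y))
    (back : ∀ l x z, G.R l (f x) z → ∃ y, F.R l x y ∧ f y = z)
    (θ : ℕ → Set G.W) (φ : ModalFormula Λ) (x : F.W) :
    F.Sat (fun p => f ⁻¹' θ p) x φ ↔ G.Sat θ (f x) φ := by
  induction φ generalizing x with
  | var p => rfl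
  | bot => rfl
  | imp φ ψ ih₁ ih₂ => simp only [sat_imp, ih₁, ih₂]
  | dia l φ ih =>
    simp only [sat_dia, ih]
    constructor
    · rintro ⟨y, hy, h⟩
      exact ⟨f y, forth l x y hy, h⟩
    · rintro ⟨z, hz, h⟩
      obtain ⟨y, hy, rfl⟩ := back l x z hz
      exact ⟨y, hy, h⟩

/-- Validity is reflected by injective bounded morphisms. -/
theorem Validates.of_injective {F : KripkeFrame.{u, v} Λ} {G : KripkeFrame.{u, w} Λ}
    {f : F.W → G.W} (hf : Function.Injective f)
    (forth : ∀ l x y, F.R l x y → G.R l (f x) (f y))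
    (back : ∀ l x z, G.R l (f x) z → ∃ y, F.R l x y ∧ f y = z)
    {φ : ModalFormula Λ} (hφ : G.Validates φ) : F.Validates φ := by
  intro θ x
  have h := (sat_comap forth back (fun p => f '' θ p) φ x).2 (hφ _ _)
  simpa only [hf.preimage_image] using h

/-- The logic of a general frame, whose admissible sets are those in `𝒜`. -/
theorem isNormalLogic_admissible (F : KripkeFrame.{u, v} Λ) (𝒜 : Set (Set F.W))
    (h𝒜 : ∀ θ : ℕ → Set F.W, (∀ p, θ p ∈ 𝒜) → ∀ φ, {w | F.Sat θ w φ} ∈ 𝒜) :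
    IsNormalLogic {φ : ModalFormula Λ | ∀ θ, (∀ p, θ p ∈ 𝒜) → ∀ w, F.Sat θ w φ} where
  taut _ hφ θ _ w := F.sat_of_isTautology θ w hφ
  axK l θ _ w := by
    simp only [sat_imp, sat_box]
    exact fun h₁ h₂ y hy => h₁ y hy (h₂ y hy)
  dual l := by
    refine ⟨fun θ _ w => ?_, fun θ _ w => ?_⟩ <;>
    · simp only [sat_imp, sat_box, sat_neg, sat_dia]
      push Not
      exact id
  mp _ _ h₁ h₂ θ hθ w := h₂ θ hθ w (h₁ θ hθ w)
  us φ ψ p h θ hθ w := (F.sat_subst θ w _ φ).2 (h _ (fun _ => h𝒜 θ hθ _) w)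
  nec l φ h θ hθ w := (F.sat_box θ w l φ).2 fun y _ => h θ hθ y

theorem isNormalLogic_validates (F : KripkeFrame.{u, v} Λ) :
    IsNormalLogic {φ : ModalFormula Λ | F.Validates φ} := by
  simpa [Validates] using F.isNormalLogic_admissible Set.univ (fun _ _ _ => trivial)

/-- The formulas valid in some member of a downward directed family of frame classes form a
normal modal logic. -/
theorem isNormalLogic_directed {α : Type*} [Nonempty α]
    (Q : α → KripkeFrame.{u, v} Λ → Prop)
    (hQ : ∀ a b, ∃ c, ∀ F, Q c F → Q a F ∧ Q b F) :
    IsNormalLogic {φ : ModalFormula Λ | ∃ a, ∀ F, Q a F → F.Validates φ} where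
  taut φ hφ := ⟨Classical.arbitrary α, fun F _ => F.isNormalLogic_validates.taut φ hφ⟩
  axK l := ⟨Classical.arbitrary α, fun F _ => F.isNormalLogic_validates.axK l⟩
  dual l := ⟨⟨Classical.arbitrary α, fun F _ => (F.isNormalLogic_validates.dual l).1⟩,
    ⟨Classical.arbitrary α, fun F _ => (F.isNormalLogic_validates.dual l).2⟩⟩
  mp φ ψ := by
    rintro ⟨a, ha⟩ ⟨b, hb⟩
    obtain ⟨c, hc⟩ := hQ a b
    exact ⟨c, fun F hF =>
      F.isNormalLogic_validates.mp φ ψ (ha F (hc F hF).1) (hb F (hc F hF).2)⟩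
  us φ ψ p := fun ⟨a, ha⟩ => ⟨a, fun F hF => F.isNormalLogic_validates.us φ ψ p (ha F hF)⟩
  nec l φ := fun ⟨a, ha⟩ => ⟨a, fun F hF => F.isNormalLogic_validates.nec l φ (ha F hF)⟩

end KripkeFrame

/-- Maximal consistent sets contain the conjunction of any finite list of their members. -/
theorem IsMCS.neg_impList_mem {Λ : Type u} {L Γ : Set (ModalFormula Λ)} (hL : IsNormalLogic L)
    (hΓ : IsMCS L Γ) {Δ : List (ModalFormula Λ)} (hΔ : ∀ φ ∈ Δ, φ ∈ Γ) :
    neg (impList Δ bot) ∈ Γ := by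
  classical
  refine hΓ.2 (y := insert (neg (impList Δ bot)) Γ) ?_ (Set.subset_insert _ _)
    (Set.mem_insert _ _)
  intro Δ' hΔ' hmem
  -- The added formula is a propositional consequence of `Δ`, so a refutation using it becomes one
  -- inside `Γ`.
  refine hΓ.1 (Δ ++ Δ'.filter (· ≠ neg (impList Δ bot))) ?_ (hL.mp _ _ hmem (hL.taut _ ?_))
  · intro φ hφ
    rcases List.mem_append.1 hφ with h | h
    · exact hΔ φ h
    · rw [List.mem_filter, decide_eq_true_eq] at h
      exact (hΔ' φ h.1).resolve_left h.2
  · intro t hbot himp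
    rw [himp, eval_impList hbot himp, eval_impList hbot himp]
    refine mt fun h φ hφ => ?_
    by_cases hc : φ = neg (impList Δ bot)
    · rw [hc, neg, himp, eval_impList hbot himp]
      exact fun h' => absurd (fun ψ hψ => h ψ (List.mem_append_left _ hψ)) h'
    · exact h φ (List.mem_append_right _ (List.mem_filter.2 ⟨hφ, by simpa using hc⟩))

/-! ### Inverse limits of finite frames -/

namespace KripkeInverseSystem

variable {Λ : Type u} {I : Type} [PartialOrder I] (S : KripkeInverseSystem.{u, v} Λ I)

/-- The sets of points of the inverse limit that are determined by a single coordinate. -/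
def levelSets : Set (Set S.limit.W) :=
  {s | ∃ (i : I) (T : Set (S.frame i).W), s = {x | x.1 i ∈ T}}

theorem mem_iff_of_mem_levelSets {s : Set S.limit.W} (hs : s ∈ S.levelSets) :
    ∃ i, ∀ j, i ≤ j → ∀ x y : S.limit.W, x.1 j = y.1 j → (x ∈ s ↔ y ∈ s) := by
  obtain ⟨i, T, rfl⟩ := hs
  refine ⟨i, fun j hj x y hxy => ?_⟩
  rw [Set.mem_ofPred_eq, Set.mem_ofPred_eq, ← x.2 j i hj, ← y.2 j i hj, hxy]

/-- Countability of `I` matters here: there are only countably many variables to name the level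
sets. -/
theorem exists_levelSets_eq_range [Nonempty I] [Countable I] (hfin : ∀ i, Finite (S.frame i).W) :
    ∃ θ : ℕ → Set S.limit.W, (∀ p, θ p ∈ S.levelSets) ∧ ∀ s ∈ S.levelSets, ∃ p, θ p = s := by
  have : Nonempty (Σ i, Set (S.frame i).W) := ⟨Classical.arbitrary I, ∅⟩
  obtain ⟨e, he⟩ := exists_surjective_nat (Σ i, Set (S.frame i).W)
  refine ⟨fun p => {x | x.1 (e p).1 ∈ (e p).2}, fun p => ⟨_, _, rfl⟩, ?_⟩
  rintro s ⟨i, T, rfl⟩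
  obtain ⟨p, hp⟩ := he ⟨i, T⟩
  refine ⟨p, ?_⟩
  beta_reduce
  rw [hp]

variable [IsDirectedOrder I]

open CategoryTheory in
/-- Compactness of the inverse limit of a system of finite sets. -/
theorem exists_limit_mem [Nonempty I] (hfin : ∀ i, Finite (S.frame i).W)
    (T : ∀ i, Set (S.frame i).W) (hne : ∀ i, (T i).Nonempty)
    (hmap : ∀ i j (h : j ≤ i), ∀ w ∈ T i, S.map i j h w ∈ T j) :
    ∃ y : S.limit.W, ∀ i, y.1 i ∈ T i := by
  let D : Iᵒᵖ ⥤ Type v :=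
    { obj := fun i => T i.unop
      map := fun {i j} f => TypeCat.ofHom
        fun w => ⟨S.map i.unop j.unop f.unop.le w.1, hmap _ _ _ _ w.2⟩
      map_id := fun i => by ext w; exact S.map_id _ _
      map_comp := fun f g => by ext w; exact (S.map_comp _ _ _ _ _ _).symm }
  have : ∀ i : Iᵒᵖ, Finite (D.obj i) := fun i => by
    have := hfin i.unop
    exact inferInstanceAs (Finite (T i.unop))
  have : ∀ i : Iᵒᵖ, Nonempty (D.obj i) := fun i => (hne i.unop).to_subtype
  obtain ⟨s, hs⟩ := nonempty_sections_of_finite_inverse_system D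
  refine ⟨⟨fun i => (s (Opposite.op i)).1, fun i j h => ?_⟩, fun i => (s (Opposite.op i)).2⟩
  exact congrArg Subtype.val (hs (homOfLE h).op)

/-- The projections of an inverse limit of finite frames satisfy the back condition. -/
theorem exists_limit_lift (hfin : ∀ i, Finite (S.frame i).W) (l : Λ) (i : I) (x : S.limit.W)
    (z : (S.frame i).W) (hz : (S.frame i).R l (x.1 i) z) :
    ∃ y, S.limit.R l x y ∧ y.1 i = z := by
  have : Nonempty I := ⟨i⟩
  -- Passing to images from stages above both `i` and `j` makes these sets compatible with the maps,
  -- even when `j` is not comparable with `i`.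
  let T (j : I) : Set (S.frame j).W :=
    {w | ∃ k, ∃ (hj : j ≤ k) (hi : i ≤ k) (w' : (S.frame k).W),
      (S.frame k).R l (x.1 k) w' ∧ S.map k i hi w' = z ∧ S.map k j hj w' = w}
  have key : ∃ y : S.limit.W, ∀ j, y.1 j ∈ T j := by
    refine S.exists_limit_mem hfin T ?_ ?_
    · intro j
      obtain ⟨k, hi, hj⟩ := exists_ge_ge i j
      obtain ⟨w', hR, hw⟩ := (S.isPMorphism k i hi).back l (x.1 k) z (by rwa [x.2 k i hi])
      exact ⟨S.map k j hj w', k, hj, hi, w', hR, hw, rfl⟩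
    · rintro j j' h w ⟨k, hj, hi, w', hR, hz, rfl⟩
      exact ⟨k, h.trans hj, hi, w', hR, hz, (S.map_comp _ _ _ _ _ _).symm⟩
  obtain ⟨y, hy⟩ := key
  refine ⟨y, fun j => ?_, ?_⟩
  · obtain ⟨k, hj, hi, w', hR, -, hw⟩ := hy j
    rw [← hw, ← x.2 k j hj]
    exact (S.isPMorphism k j hj).forth _ _ _ hR
  · obtain ⟨k, hj, hi, w', -, hz, hw⟩ := hy i
    rw [← hw, ← hz]

/-- Under a valuation by level sets, the truth of a formula in the limit agrees with its truth
at every sufficiently late stage. -/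
theorem sat_limit_iff_sat_frame [Nonempty I] (hfin : ∀ i, Finite (S.frame i).W)
    {θ : ℕ → Set S.limit.W} (hθ : ∀ p, θ p ∈ S.levelSets) (φ : ModalFormula Λ) :
    ∃ i, ∀ j, i ≤ j → ∀ x, S.limit.Sat θ x φ ↔
      (S.frame j).Sat (fun p => (fun y : S.limit.W => y.1 j) '' θ p) (x.1 j) φ := by
  induction φ with
  | var p =>
    obtain ⟨i, hi⟩ := S.mem_iff_of_mem_levelSets (hθ p)
    refine ⟨i, fun j hj x => ⟨fun h => ⟨x, h, rfl⟩, ?_⟩⟩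
    rintro ⟨y, hy, hyx⟩
    exact (hi j hj y x hyx).1 hy
  | bot => exact ⟨Classical.arbitrary I, fun j _ x => Iff.rfl⟩
  | imp φ ψ ih₁ ih₂ =>
    obtain ⟨i₁, h₁⟩ := ih₁
    obtain ⟨i₂, h₂⟩ := ih₂
    obtain ⟨k, hk₁, hk₂⟩ := exists_ge_ge i₁ i₂
    refine ⟨k, fun j hj x => ?_⟩
    rw [KripkeFrame.sat_imp, KripkeFrame.sat_imp, h₁ j (hk₁.trans hj), h₂ j (hk₂.trans hj)]
  | dia l φ ih =>
    obtain ⟨i, h⟩ := ih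
    -- No later stage is needed, as the projections satisfy the back condition.
    refine ⟨i, fun j hj x => ?_⟩
    rw [KripkeFrame.sat_dia, KripkeFrame.sat_dia]
    constructor
    · rintro ⟨y, hR, hy⟩
      exact ⟨y.1 j, hR j, (h j hj y).1 hy⟩
    · rintro ⟨z, hR, hz⟩
      obtain ⟨y, hxy, rfl⟩ := S.exists_limit_lift hfin l j x z hR
      exact ⟨y, hxy, (h j hj y).2 hz⟩

theorem setOf_sat_mem_levelSets [Nonempty I] (hfin : ∀ i, Finite (S.frame i).W)
    {θ : ℕ → Set S.limit.W} (hθ : ∀ p, θ p ∈ S.levelSets) (φ : ModalFormula Λ) :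
    {x | S.limit.Sat θ x φ} ∈ S.levelSets := by
  obtain ⟨i, h⟩ := S.sat_limit_iff_sat_frame hfin hθ φ
  exact ⟨i, {w | (S.frame i).Sat (fun p => (fun y : S.limit.W => y.1 i) '' θ p) w φ},
    Set.ext fun x => h i le_rfl x⟩

/-- A set of formulas that is finitely satisfiable among the successors of a point is satisfied at
some successor. -/
theorem exists_successor_sat [Nonempty I] (hfin : ∀ i, Finite (S.frame i).W)
    {θ : ℕ → Set S.limit.W} (hθ : ∀ p, θ p ∈ S.levelSets) (l : Λ) (x : S.limit.W)
    (Γ : Set (ModalFormula Λ))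
    (hΓ : ∀ Δ : List (ModalFormula Λ), (∀ φ ∈ Δ, φ ∈ Γ) →
      ∃ y, S.limit.R l x y ∧ ∀ φ ∈ Δ, S.limit.Sat θ y φ) :
    ∃ y, S.limit.R l x y ∧ ∀ φ ∈ Γ, S.limit.Sat θ y φ := by
  -- The successor may depend on `Δ`; only its coordinate at `j` is fixed.
  let T (j : I) : Set (S.frame j).W :=
    {w | ∀ Δ : List (ModalFormula Λ), (∀ φ ∈ Δ, φ ∈ Γ) →
      ∃ y, S.limit.R l x y ∧ (∀ φ ∈ Δ, S.limit.Sat θ y φ) ∧ y.1 j = w}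
  have key : ∃ y : S.limit.W, ∀ j, y.1 j ∈ T j := by
    refine S.exists_limit_mem hfin T ?_ ?_
    · intro j
      -- Otherwise each of the finitely many points fails some list, and the concatenation of these
      -- lists is not satisfiable at a successor.
      by_contra hne
      rw [Set.not_nonempty_iff_eq_empty, Set.eq_empty_iff_forall_notMem] at hne
      simp only [T, Set.mem_ofPred_eq, not_forall] at hne
      choose Δ hΔ h using hne
      have := Fintype.ofFinite (S.frame j).W
      obtain ⟨y, hR, hy⟩ := hΓ (Finset.univ.toList.flatMap Δ) (by
        intro φ hφ
        obtain ⟨w, -, hw⟩ := List.mem_flatMap.1 hφ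
        exact hΔ w φ hw)
      exact h (y.1 j) ⟨y, hR, fun φ hφ =>
        hy φ (List.mem_flatMap.2 ⟨y.1 j, by simp, hφ⟩), rfl⟩
    · intro i j h w hw Δ hΔ
      obtain ⟨y, hR, hy, rfl⟩ := hw Δ hΔ
      exact ⟨y, hR, hy, (y.2 i j h).symm⟩
  obtain ⟨y, hy⟩ := key
  refine ⟨y, fun j => ?_, fun φ hφ => ?_⟩
  · obtain ⟨y', hR, -, h⟩ := hy j [] (by simp)
    exact h ▸ hR j
  · obtain ⟨i, hi⟩ := S.sat_limit_iff_sat_frame hfin hθ φ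
    obtain ⟨y', -, h', h⟩ := hy i [φ] (by simpa using hφ)
    rw [hi i le_rfl, ← h, ← hi i le_rfl]
    exact h' φ (by simp)

/-- Canonical formulas are preserved under countable inverse limits of finite frames. -/
theorem limit_validates_of_isCanonical [Nonempty I] [Countable I]
    (hfin : ∀ i, Finite (S.frame i).W) {φ : ModalFormula Λ} (hφ : IsCanonical φ)
    (hS : ∀ i, (S.frame i).Validates φ) : S.limit.Validates φ := by
  obtain ⟨θ, hθ, hsurj⟩ := S.exists_levelSets_eq_range hfin
  -- Only level-set valuations are claimed; passing to arbitrary ones is what canonicity provides.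
  have hsound : KPlus {φ} ⊆ {ψ | ∀ θ : ℕ → Set S.limit.W, (∀ p, θ p ∈ S.levelSets) →
      ∀ x, S.limit.Sat θ x ψ} := by
    refine Set.sInter_subset_of_mem ⟨S.limit.isNormalLogic_admissible S.levelSets
      fun θ hθ ψ => S.setOf_sat_mem_levelSets hfin hθ ψ, ?_⟩
    intro ψ hψ θ hθ x
    rw [Set.mem_singleton_iff.1 hψ]
    obtain ⟨i, hi⟩ := S.sat_limit_iff_sat_frame hfin hθ φ
    exact (hi i le_rfl x).2 (hS i _ _)
  have hmcs (x : S.limit.W) : IsMCS (KPlus {φ}) {ψ | S.limit.Sat θ x ψ} := by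
    refine ⟨fun Δ hΔ hmem => ?_, fun Γ hΓ hle ψ hψ => ?_⟩
    · exact (S.limit.sat_impList_bot θ x Δ).1 (hsound hmem θ hθ x) hΔ
    · by_contra hn
      refine hΓ [neg ψ, ψ] ?_ ((axiomatises_KPlus _).1.1.taut _ ?_)
      · simpa using ⟨hle ((S.limit.sat_neg θ x ψ).2 hn), hψ⟩
      · intro t hbot himp
        rw [eval_impList hbot himp]
        simp [neg, himp, hbot]
  refine KripkeFrame.Validates.of_injective (G := canonicalFrame (KPlus {φ}))
    (f := fun x => ⟨_, hmcs x⟩) ?_ ?_ ?_ hφ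
  · intro x y hxy
    refine Subtype.ext (funext fun i => ?_)
    obtain ⟨p, hp⟩ := hsurj _ ⟨i, {y.1 i}, rfl⟩
    have h := congrArg (fun Γ => var p ∈ Γ.1) hxy
    have hy : y ∈ θ p := by rw [hp]; rfl
    have hx : x ∈ θ p := h.mpr hy
    rw [hp] at hx
    exact hx
  · intro l x y hxy ψ hψ
    exact ⟨y, hxy, hψ⟩
  · intro l x Γ hΓ
    obtain ⟨y, hR, hy⟩ := S.exists_successor_sat hfin hθ l x Γ.1 fun Δ hΔ => by
      obtain ⟨y, hR, hy⟩ := hΓ _ (Γ.2.neg_impList_mem (axiomatises_KPlus _).1.1 hΔ)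
      rw [KripkeFrame.sat_neg, KripkeFrame.sat_impList_bot, not_not] at hy
      exact ⟨y, hR, hy⟩
    -- The theory of `y` is consistent and contains the maximal set `Γ`, hence equals it.
    exact ⟨y, hR, Subtype.ext ((Γ.2.2 (hmcs y).1 hy).antisymm hy)⟩

end KripkeInverseSystem

/-! ### Semantic finiteness of axiomatisations and the conclusion -/

/-- A finite set of theorems of `K + {γ n}` is valid in all frames of a single `γ k`. -/
theorem exists_validates_of_finite_subset_KPlus {Λ : Type u} {γ : ℕ → ModalFormula Λ}
    (hγ : ∀ i₁ i₂ : ℕ, i₂ < i₁ →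
      ∀ F : KripkeFrame.{u, v} Λ, F.Validates (γ i₁) → F.Validates (γ i₂))
    {B : Set (ModalFormula Λ)} (hB : B.Finite) (hsub : B ⊆ KPlus (Set.range γ)) :
    ∃ k, ∀ F : KripkeFrame.{u, v} Λ, F.Validates (γ k) → ∀ φ ∈ B, F.Validates φ := by
  have hle {i j : ℕ} (hij : i ≤ j) (F : KripkeFrame.{u, v} Λ) (h : F.Validates (γ j)) :
      F.Validates (γ i) := by
    rcases hij.eq_or_lt with rfl | hlt
    exacts [h, hγ j i hlt F h]
  have hL : KPlus (Set.range γ) ⊆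
      {φ | ∃ k, ∀ F : KripkeFrame.{u, v} Λ, F.Validates (γ k) → F.Validates φ} := by
    refine Set.sInter_subset_of_mem ⟨KripkeFrame.isNormalLogic_directed
      (fun k F => F.Validates (γ k)) fun a b => ⟨max a b, fun F h =>
        ⟨hle (le_max_left a b) F h, hle (le_max_right a b) F h⟩⟩, ?_⟩
    rintro _ ⟨k, rfl⟩
    exact ⟨k, fun F h => h⟩
  induction B, hB using Set.Finite.induction_on with
  | empty => exact ⟨0, fun F _ φ hφ => hφ.elim⟩
  | @insert a B _ _ ih =>
    obtain ⟨ha, hsub⟩ := Set.insert_subset_iff.1 hsub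
    obtain ⟨i, hi⟩ := ih hsub
    obtain ⟨j, hj⟩ := hL ha
    refine ⟨max i j, fun F hF φ hφ => ?_⟩
    rcases hφ with rfl | hφ
    · exact hj F (hle (le_max_right i j) F hF)
    · exact hi F (hle (le_max_left i j) F hF) φ hφ

/-- Theorems of an axiomatised logic follow semantically from finitely many axioms. -/
theorem Axiomatises.exists_finite_validates {Λ : Type u} {A L : Set (ModalFormula Λ)}
    (hA : Axiomatises A L) {φ : ModalFormula Λ} (hφ : φ ∈ L) :
    ∃ B ⊆ A, B.Finite ∧ ∀ F : KripkeFrame.{u, v} Λ, (∀ ψ ∈ B, F.Validates ψ) →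
      F.Validates φ := by
  have : Nonempty {B : Set (ModalFormula Λ) // B ⊆ A ∧ B.Finite} :=
    ⟨∅, Set.empty_subset _, Set.finite_empty⟩
  obtain ⟨⟨B, hBA, hB⟩, h⟩ := hA.2 ⟨KripkeFrame.isNormalLogic_directed
    (fun (B : {B : Set (ModalFormula Λ) // B ⊆ A ∧ B.Finite}) (F : KripkeFrame.{u, v} Λ) =>
      ∀ ψ ∈ B.1, F.Validates ψ) fun B C =>
        ⟨⟨B.1 ∪ C.1, Set.union_subset B.2.1 C.2.1, B.2.2.union C.2.2⟩, fun F hF =>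
          ⟨fun ψ hψ => hF ψ (Or.inl hψ), fun ψ hψ => hF ψ (Or.inr hψ)⟩⟩,
    fun ψ hψ => ⟨⟨{ψ}, Set.singleton_subset_iff.2 hψ, Set.finite_singleton ψ⟩,
      fun F hF => hF ψ rfl⟩⟩ hφ
  exact ⟨B, hBA, hB, h⟩

theorem mainTheorem2 {Λ : Type u} (γ : ℕ → ModalFormula Λ)
    (hγ : ∀ i₁ i₂ : ℕ, i₂ < i₁ →
      ∀ F : KripkeFrame.{u, v} Λ, F.Validates (γ i₁) → F.Validates (γ i₂))
    (hsys : ∀ l : ℕ, ∃ n : ℕ, ∀ k : ℕ,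
      ∃ (I : Type) (_ : PartialOrder I) (_ : Nonempty I) (_ : IsDirectedOrder I) (_ : Countable I)
        (S : KripkeInverseSystem.{u, v} Λ I),
        (∀ i, Finite (S.frame i).W) ∧
        (∀ i, (S.frame i).Validates (γ k)) ∧
        S.limit.Validates (γ l) ∧
        ¬ S.limit.Validates (γ n)) :
    ∀ A : Set (ModalFormula Λ), Axiomatises A (KPlus (Set.range γ)) →
      {φ ∈ A | ¬ IsCanonical φ}.Infinite := by
  intro A hA hfin
  obtain ⟨l, hl⟩ := exists_validates_of_finite_subset_KPlus hγ hfin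
    ((Set.sep_subset _ _).trans hA.1.2)
  obtain ⟨n, hn⟩ := hsys l
  obtain ⟨B, hBA, hB, hBn⟩ := hA.exists_finite_validates
    ((axiomatises_KPlus (Set.range γ)).1.2 ⟨n, rfl⟩)
  -- `k` depends on `B`, hence on `n`; the hypothesis allows this since `n` is chosen before `k`.
  obtain ⟨k, hk⟩ := exists_validates_of_finite_subset_KPlus hγ hB (hBA.trans hA.1.2)
  obtain ⟨I, _, _, _, _, S, hS, hSk, hSl, hSn⟩ := hn k
  refine hSn (hBn S.limit fun ψ hψ => ?_)
  by_cases hc : IsCanonical ψ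
  · exact S.limit_validates_of_isCanonical hS hc fun i => hk _ (hSk i) ψ hψ
  · exact hl S.limit hSl ψ ⟨hBA hψ, hc⟩
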